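/- Let $g$ be a positive integer. A *noncommutative domain* $\mathcal U=(\mathcal U(n))_{n}$ in $M(\mathbb C)^g$ is a sequence of nonempty, open, connected sets $\mathcal U(n)\subseteq M_n(\mathbb C)^g$ that is closed under simultaneous unitary similarity ($X\in\mathcal U(n)$ and $W$ an $n\times n$ unitary imply $(W^*X_1W,\dots,W^*X_gW)\in\mathcal U(n)$) and under direct sums ($X\in\mathcal U(m)$ and $Y\in\mathcal U(n)$ imply $X\oplus Y=(X_1\oplus Y_1,\dots,X_g\oplus Y_g)\in\mathcal U(m+n)$). It is *bounded* if there is a single $C\in\mathbb R$ with $C^2I-\sum_j X_jX_j^*\succ 0$ for all $n$ and all $X\in\mathcal U(n)$; it *contains $0$* if $0\in\mathcal U(n)$ for every $n$; it is *circular* if $e^{it}X\in\mathcal U(n)$ whenever $X\in\mathcal U(n)$ and $t\in\mathbb R$; and it is *weakly convex* if each $\mathcal U(n)$ is a convex set. A *free analytic map* $f:\mathcal U\to\mathcal V$ between noncommutative domains in $M(\mathbb C)^g$ is a sequence of analytic functions $f[n]:\mathcal U(n)\to\mathcal V(n)$ that respects direct sums ($f[m+n](X\oplus Y)=f[m](X)\oplus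 f[n](Y)$) and similarity (if $X,Y\in\mathcal U(n)$, $\Gamma$ is an invertible $n\times n$ matrix and $X_j\Gamma=\Gamma Y_j$ for all $j$, then $f[n](X)_j\,\Gamma=\Gamma\, f[n](Y)_j$ for all $j$). It is *proper* if for every $n$ and every compact $K\subseteq\mathcal V(n)$ the preimage $f[n]^{-1}(K)\subseteq\mathcal U(n)$ is compact. **Corollary.** Let $\mathcal U$ and $\mathcal V$ be bounded circular noncommutative domains in $M(\mathbb C)^g$, both of which contain $0$, and let $f:\mathcal U\to\mathcal V$ be a proper free analytic map with $f(0)=0$ (that is, $f[n](0)=0$ for every $n$). Then $\mathcal U$ is weakly convex if and only if $\mathcal V$ is weakly convex. -/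

import Mathlib

namespace NC

/-- The space `M_n(ℂ)^g` of `g`-tuples of complex `n × n` matrices. -/
abbrev Tuple (g n : ℕ) : Type := Fin g → Matrix (Fin n) (Fin n) ℂ

/-- The direct sum of two tuples, formed entrywise as block diagonal matrices. -/
def directSum {g m n : ℕ} (X : Tuple g m) (Y : Tuple g n) : Tuple g (m + n) := fun i =>
  Matrix.reindex finSumFinEquiv finSumFinEquiv (Matrix.fromBlocks (X i) 0 0 (Y i))

/-- A sequence `(U(n))` of subsets of `M_n(ℂ)^g`. The level `n = 0`, a one-point space,
is carried along; no definition below says anything of substance about it. -/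
abbrev SetSeq (g : ℕ) : Type := ∀ n : ℕ, Set (Tuple g n)

/-- A sequence of functions `f[n]` on `M_n(ℂ)^g`; for a map with domain `U`, only the values
on `U(n)` are ever looked at. -/
abbrev MapSeq (g h : ℕ) : Type := ∀ n : ℕ, Tuple g n → Tuple h n

/-- Noncommutative set: closed under simultaneous unitary similarity and direct sums. -/
structure IsNCSet {g : ℕ} (U : SetSeq g) : Prop where
  unitary_conj_mem : ∀ (n : ℕ) (X : Tuple g n), X ∈ U n →
    ∀ W ∈ Matrix.unitaryGroup (Fin n) ℂ, (fun i => W.conjTranspose * X i * W) ∈ U n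
  directSum_mem : ∀ (m n : ℕ) (X : Tuple g m) (Y : Tuple g n), X ∈ U m → Y ∈ U n →
    directSum X Y ∈ U (m + n)

/-- Noncommutative domain: a noncommutative set with every level nonempty, open and connected. -/
structure IsNCDomain {g : ℕ} (U : SetSeq g) : Prop extends IsNCSet U where
  isOpen : ∀ n : ℕ, IsOpen (U n)
  -- `IsConnected` includes nonemptiness
  isConnected : ∀ n : ℕ, IsConnected (U n)

section

open scoped ComplexOrder

/-- Boundedness, with one constant for all levels: `C² - ∑ Xⱼ Xⱼ* ≻ 0`. -/
def IsBounded {g : ℕ} (U : SetSeq g) : Prop :=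
  ∃ C : ℝ, ∀ (n : ℕ) (X : Tuple g n), X ∈ U n →
    (((C : ℂ) ^ 2) • (1 : Matrix (Fin n) (Fin n) ℂ) - ∑ j, X j * (X j).conjTranspose).PosDef

end

/-- Every level is invariant under multiplication by `exp(it)`, `t` real. -/
def IsCircular {g : ℕ} (U : SetSeq g) : Prop :=
  ∀ (n : ℕ) (X : Tuple g n), X ∈ U n →
    ∀ t : ℝ, Complex.exp ((t : ℂ) * Complex.I) • X ∈ U n

/-- Every level is a convex set. -/
def IsWeaklyConvex {g : ℕ} (U : SetSeq g) : Prop :=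
  ∀ n : ℕ, Convex ℝ (U n)

/-- For open sets, in particular for the levels of a noncommutative domain, convexity is the
same as being closed under midpoints. -/
theorem convex_iff_midpoint {g n : ℕ} {S : Set (Tuple g n)} (hS : IsOpen S) :
    Convex ℝ S ↔ ∀ X ∈ S, ∀ Y ∈ S, (1 / 2 : ℝ) • (X + Y) ∈ S := by
  constructor
  · intro h X hX Y hY
    rw [smul_add]
    exact h hX hY (by norm_num) (by norm_num) (by norm_num)
  · intro h
    have key : ∀ m k : ℕ, k ≤ 2 ^ m → ∀ X ∈ S, ∀ Y ∈ S,
        X + ((k : ℝ) / 2 ^ m) • (Y - X) ∈ S := by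
      intro m
      induction m with
      | zero =>
        intro k hk X hX Y hY
        have hk' : k = 0 ∨ k = 1 := by rw [pow_zero] at hk; omega
        rcases hk' with rfl | rfl
        · simpa using hX
        · simpa using hY
      | succ m ih =>
        intro k hk X hX Y hY
        by_cases hkm : k ≤ 2 ^ m
        · have := h X hX _ (ih k hkm X hX Y hY)
          convert this using 1
          rw [pow_succ]
          module
        · have hk2 : k - 2 ^ m ≤ 2 ^ m := by rw [pow_succ] at hk; omega
          have := h Y hY _ (ih _ hk2 X hX Y hY)
          convert this using 1
          have h2 : (2 : ℝ) ^ m ≠ 0 := by positivity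
          have e : (k : ℝ) / 2 ^ (m + 1) = 1 / 2 + (1 / 2) * (((k - 2 ^ m : ℕ) : ℝ) / 2 ^ m) := by
            rw [Nat.cast_sub (by omega)]
            push_cast
            field_simp
            ring
          rw [e]
          module
    intro X hX Y hY a b ha hb hab
    have hlim : Filter.Tendsto (fun m : ℕ => b - (⌊b * 2 ^ m⌋₊ : ℝ) / 2 ^ m)
        Filter.atTop (nhds 0) := by
      have hz : Filter.Tendsto (fun m : ℕ => ((1 / 2 : ℝ)) ^ m) Filter.atTop (nhds 0) :=
        tendsto_pow_atTop_nhds_zero_of_lt_one (by norm_num) (by norm_num)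
      refine squeeze_zero (fun m => ?_) (fun m => ?_) hz
      · rw [sub_nonneg, div_le_iff₀ (by positivity)]
        exact Nat.floor_le (by positivity)
      · rw [one_div, inv_pow, sub_le_iff_le_add, ← one_div, ← add_div,
          le_div_iff₀ (by positivity), add_comm]
        exact (Nat.lt_floor_add_one _).le
    have hd : ∀ Z ∈ S, ∀ᶠ m : ℕ in Filter.atTop,
        Z + (b - (⌊b * 2 ^ m⌋₊ : ℝ) / 2 ^ m) • (Y - X) ∈ S := by
      intro Z hZ
      have ht := (hlim.smul_const (Y - X)).const_add Z
      rw [zero_smul, add_zero] at ht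
      exact ht.eventually (hS.mem_nhds hZ)
    obtain ⟨m, h1, h2⟩ := ((hd X hX).and (hd Y hY)).exists
    have hfl : ⌊b * 2 ^ m⌋₊ ≤ 2 ^ m := by
      apply Nat.floor_le_of_le
      push_cast
      have : (0 : ℝ) < 2 ^ m := by positivity
      nlinarith
    have h3 := key m _ hfl _ h1 _ h2
    convert h3 using 1
    obtain rfl : a = 1 - b := by linarith
    module

/-- `f` is a free map on `U`: it respects direct sums and similarity. -/
structure IsFreeMapOn {g h : ℕ} (f : MapSeq g h) (U : SetSeq g) : Prop where
  map_directSum : ∀ (m n : ℕ) (X : Tuple g m) (Y : Tuple g n), X ∈ U m → Y ∈ U n →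
    f (m + n) (directSum X Y) = directSum (f m X) (f n Y)
  map_similar : ∀ (n : ℕ) (X Y : Tuple g n), X ∈ U n → Y ∈ U n →
    ∀ Γ : Matrix (Fin n) (Fin n) ℂ, IsUnit Γ →
      (∀ i, X i * Γ = Γ * Y i) → ∀ i, f n X i * Γ = Γ * f n Y i

section

-- The entrywise sup norm; in finite dimension analyticity does not depend on the norm.
attribute [local instance] Matrix.normedAddCommGroup Matrix.normedSpace

/-- Each `f[n]` is (complex) analytic on `U(n)`. -/
def IsAnalyticOn {g h : ℕ} (f : MapSeq g h) (U : SetSeq g) : Prop :=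
  ∀ n : ℕ, AnalyticOnNhd ℂ (f n) (U n)

end

/-- `f` maps `U` into `V`, level by level. -/
def MapsInto {g h : ℕ} (f : MapSeq g h) (U : SetSeq g) (V : SetSeq h) : Prop :=
  ∀ n : ℕ, Set.MapsTo (f n) (U n) (V n)

/-- The preimage in `U(n)` of each compact subset of `V(n)` is compact. -/
def IsProper {g h : ℕ} (f : MapSeq g h) (U : SetSeq g) (V : SetSeq h) : Prop :=
  ∀ (n : ℕ) (K : Set (Tuple h n)), K ⊆ V n → IsCompact K → IsCompact (U n ∩ f n ⁻¹' K)

end NC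

/-! At each level `f` turns out to be the restriction of an injective linear map with image `V n`,
and such a map carries convexity both ways. Two ingredients give this. Noncommutative: `X ⊕ Y` is
similar to the upper triangular tuple with diagonal `X`, `Y` and corner `γ (X - Y)`, so `f` sends
that tuple to the one with corner `γ (f X - f Y)`. If `f X = f Y`, a whole complex line of such
tuples lies over one point, which properness forbids; hence `f` is injective at every level. Letting
`Y` tend to `X` puts the derivative in the corner, so injectivity at level `2n` makes every
derivative at level `n` injective. Then `f` is open, and properness makes it onto. Classical: a
biholomorphic map of circular domains fixing `0`, with bounded source, is linear. Conjugating by a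
rotation and composing with the inverse gives a self-map tangent to the identity at `0`; by Cartan's
uniqueness theorem it is the identity, so `f` commutes with rotations. -/

open Filter Topology Asymptotics Set

/-! ### Cartan's theorems, local inversion and proper maps -/

section Cartan

variable {E : Type*} [NormedAddCommGroup E] [NormedSpace ℂ E]

/-- Cauchy's estimate for the first nonvanishing Taylor coefficient. -/
theorem norm_le_of_sub_pow_smul_isBigO [CompleteSpace E] {ψ : ℂ → E} {c : E} {k : ℕ} {M : ℝ}
    (hd : DifferentiableOn ℂ ψ (Metric.ball 0 2)) (hM : ∀ z : ℂ, ‖z‖ = 1 → ‖ψ z‖ ≤ M)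
    (hO : (fun z => ψ z - z ^ k • c) =O[𝓝 0] fun z => ‖z‖ ^ (k + 1)) : ‖c‖ ≤ M := by
  classical
  -- The quotient `ψ z / z ^ k` has a removable singularity with value `c`; the maximum principle on
  -- the unit disc then bounds `c`.
  set χ : ℂ → E := Function.update (fun z => (z ^ k)⁻¹ • ψ z) 0 c with hχ
  have hne : ∀ z : ℂ, z ≠ 0 → χ z = (z ^ k)⁻¹ • ψ z := fun z hz => Function.update_of_ne hz _ _
  have hcont : ContinuousAt χ 0 := by
    rw [hχ, continuousAt_update_same, ← tendsto_sub_nhds_zero_iff]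
    have hO' : (fun z => ψ z - z ^ k • c) =O[𝓝[≠] 0] fun z => z ^ (k + 1) := by
      simpa only [← norm_pow, isBigO_norm_right] using hO.mono (nhdsWithin_le_nhds (s := {0}ᶜ))
    have h1 : (fun z : ℂ => (z ^ k)⁻¹ • (ψ z - z ^ k • c)) =O[𝓝[≠] 0] fun z => ‖z‖ := by
      have h2 := (isBigO_refl (fun z : ℂ => (z ^ k)⁻¹) (𝓝[≠] 0)).smul hO'
      refine h2.trans (IsBigO.of_bound 1 ?_)
      filter_upwards [self_mem_nhdsWithin] with z hz
      have : ‖z‖ ≠ 0 := norm_ne_zero_iff.2 hz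
      rw [norm_smul, norm_inv, norm_pow, norm_pow, norm_norm, pow_succ, one_mul,
        ← mul_assoc, inv_mul_cancel₀ (pow_ne_zero k this), one_mul]
    have h3 : Tendsto (fun z : ℂ => (z ^ k)⁻¹ • (ψ z - z ^ k • c)) (𝓝[≠] 0) (𝓝 0) :=
      h1.trans_tendsto (tendsto_norm_zero.mono_left nhdsWithin_le_nhds)
    refine h3.congr' ?_
    filter_upwards [self_mem_nhdsWithin] with z hz
    rw [smul_sub, smul_smul, inv_mul_cancel₀ (pow_ne_zero k hz), one_smul]
  have hdiff : DifferentiableOn ℂ χ (Metric.ball 0 2) := by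
    rw [← Complex.differentiableOn_compl_singleton_and_continuousAt_iff
      (Metric.ball_mem_nhds (0 : ℂ) two_pos)]
    refine ⟨?_, hcont⟩
    refine DifferentiableOn.congr (f := fun z => (z ^ k)⁻¹ • ψ z) ?_ fun z hz => hne z hz.2
    refine DifferentiableOn.smul (fun z hz => ?_) (hd.mono sdiff_subset)
    exact ((differentiableAt_id.pow k).inv (pow_ne_zero k hz.2)).differentiableWithinAt
  have hcl : DiffContOnCl ℂ χ (Metric.ball 0 1) := by
    refine (hdiff.mono ?_).diffContOnCl
    rw [closure_ball _ one_ne_zero]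
    exact Metric.closedBall_subset_ball (by norm_num)
  have := Complex.norm_le_of_forall_mem_frontier_norm_le Metric.isBounded_ball hcl (C := M)
    (fun z hz => ?_) (subset_closure (Metric.mem_ball_self (x := (0 : ℂ)) one_pos))
  · simpa [hχ] using this
  · rw [frontier_ball _ one_ne_zero, mem_sphere_zero_iff_norm] at hz
    have hz0 : z ≠ 0 := by rintro rfl; simp at hz
    rw [hne z hz0, norm_smul, norm_inv, norm_pow, hz]
    simpa using hM z hz

/-- Each application of `F` adds one more copy of `P`: replacing `y` by `F^[m] y = y + O(‖y‖ ^ k)`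
inside `P` costs only `O(‖y‖ ^ (2k - 1))`, and `2k - 1 ≥ k + 1` because `k ≥ 2`. -/
theorem iterate_sub_isBigO {F : E → E} {k : ℕ} (hk : 2 ≤ k) {P : E [×k]→L[ℂ] E}
    (h : (fun y => F y - (y + P fun _ => y)) =O[𝓝 0] fun y => ‖y‖ ^ (k + 1)) (m : ℕ) :
    (fun y => F^[m] y - (y + (m : ℂ) • P fun _ => y)) =O[𝓝 0] fun y => ‖y‖ ^ (k + 1) := by
  have hpow : ∀ a b : ℕ, a ≤ b →
      (fun y : E => ‖y‖ ^ b) =O[𝓝 0] fun y => ‖y‖ ^ a := fun a b hab => by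
    have h1 : (fun y : E => ‖y‖ ^ (b - a)) =O[𝓝 0] fun _ => (1 : ℝ) :=
      (continuous_norm.pow _).continuousAt.isBigO_one _
    have h2 := (isBigO_refl (fun y : E => ‖y‖ ^ a) (𝓝 0)).mul h1
    simpa [← pow_add, Nat.add_sub_cancel' hab] using h2
  have hP : (fun y : E => P fun _ => y) =O[𝓝 0] fun y => ‖y‖ ^ k := by
    refine IsBigO.of_bound ‖P‖ (Eventually.of_forall fun y => ?_)
    simpa using P.le_opNorm fun _ => y
  induction m with
  | zero => simpa using isBigO_zero _ _
  | succ m ih =>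
    have hw1 : (fun y => F^[m] y - y) =O[𝓝 0] fun y => ‖y‖ ^ k := by
      have := (ih.trans (hpow k (k + 1) (by omega))).add (hP.const_smul_left (m : ℂ))
      refine this.congr_left fun y => ?_
      simp only [Pi.smul_apply]
      abel
    have hw : (fun y => F^[m] y) =O[𝓝 0] fun y => ‖y‖ := by
      have h1 : (fun y : E => y) =O[𝓝 0] fun y => ‖y‖ := (isBigO_refl _ _).norm_right
      have := (hw1.trans (hpow 1 k (by omega))).add (g := fun y => ‖y‖ ^ 1) (by simpa using h1)
      simpa using this
    have hw0 : Tendsto (fun y => F^[m] y) (𝓝 0) (𝓝 0) := hw.trans_tendsto tendsto_norm_zero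
    have t1 : (fun y => F (F^[m] y) - (F^[m] y + P fun _ => F^[m] y)) =O[𝓝 0]
        fun y => ‖y‖ ^ (k + 1) :=
      (h.comp_tendsto hw0).trans (hw.norm_left.pow (k + 1))
    have t2 : (fun y => (P fun _ => F^[m] y) - P fun _ => y) =O[𝓝 0]
        fun y => ‖y‖ ^ (k + 1) := by
      have hmax : (fun y => ‖F^[m] y‖ + ‖y‖) =O[𝓝 0] fun y => ‖y‖ :=
        hw.norm_left.add (isBigO_refl _ _)
      have h2 := ((hmax.pow (k - 1)).mul hw1.norm_left).const_mul_left (‖P‖ * k)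
      refine IsBigO.trans (IsBigO.of_bound 1 (Eventually.of_forall fun y => ?_))
        (h2.trans ?_)
      · refine (P.norm_image_sub_le _ _).trans ?_
        rw [one_mul, Real.norm_of_nonneg (by positivity), Fintype.card_fin, mul_assoc]
        have hn : ∀ x : E, ‖fun _ : Fin k => x‖ ≤ ‖x‖ := fun x => pi_norm_const_le x
        have e : ((fun _ : Fin k => F^[m] y) - fun _ => y) = fun _ => F^[m] y - y := rfl
        rw [e]
        gcongr
        · exact max_le ((hn _).trans (by simp)) ((hn _).trans (by simp))
        · exact hn _
      · simp_rw [← pow_add]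
        exact hpow _ _ (by omega)
    refine ((t1.add ih).add t2).congr_left fun y => ?_
    rw [Function.iterate_succ_apply']
    push_cast
    rw [add_smul, one_smul]
    abel

theorem analyticOnNhd_iterate {U : Set E} {F : E → E} (hF : AnalyticOnNhd ℂ F U)
    (hm : MapsTo F U U) (m : ℕ) : AnalyticOnNhd ℂ F^[m] U := by
  induction m with
  | zero => exact analyticOnNhd_id
  | succ m ih => exact ih.comp hF hm

/-- Cartan's uniqueness theorem. -/
theorem eqOn_id_of_mapsTo_of_fderiv_eq_id [CompleteSpace E] {U : Set E} (hUo : IsOpen U)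
    (hUc : IsPreconnected U) (hUb : Bornology.IsBounded U) (h0 : (0 : E) ∈ U) {F : E → E}
    (hF : AnalyticOnNhd ℂ F U) (hm : MapsTo F U U) (hF0 : F 0 = 0)
    (hd : fderiv ℂ F 0 = ContinuousLinearMap.id ℂ E) : EqOn F id U := by
  obtain ⟨p, hp⟩ := hF 0 h0
  have hp0 : ∀ y, (p 0 fun _ => y) = 0 := fun y => by
    rw [hp.coeff_zero, hF0]
  have hp1 : ∀ y, (p 1 fun _ => y) = y := fun y => by
    have := hp.hasFDerivAt.fderiv
    rw [hd] at this
    have h : p 1 ![y] = y := by simpa using (DFunLike.congr_fun this y).symm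
    rwa [Matrix.cons_fin_one] at h
  obtain ⟨C, hC⟩ := hUb.exists_norm_le
  obtain ⟨r, hr, hrU⟩ := Metric.isOpen_iff.1 hUo 0 h0
  have key : ∀ k, 2 ≤ k → ∀ y, (p k fun _ => y) = 0 := by
    intro k
    induction k using Nat.strong_induction_on with
    | _ k ih =>
      intro hk
      have h1 : (fun y => F y - (y + p k fun _ => y)) =O[𝓝 0] fun y => ‖y‖ ^ (k + 1) := by
        refine (hp.isBigO_sub_partialSum_pow (k + 1)).congr_left fun y => ?_
        rw [zero_add, FormalMultilinearSeries.partialSum, Finset.sum_range_succ,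
          Finset.sum_eq_single_of_mem 1 (Finset.mem_range.2 (by omega)), hp1]
        intro b hb hb1
        rcases Nat.lt_or_ge b 2 with h | h
        · obtain rfl : b = 0 := by omega
          exact hp0 y
        · exact ih b (Finset.mem_range.1 hb) h y
      have small : ∀ y : E, 2 * ‖y‖ < r → (p k fun _ => y) = 0 := by
        intro y hy
        have hzy : ∀ z ∈ Metric.ball (0 : ℂ) 2, z • y ∈ U := fun z hz => by
          apply hrU
          rw [mem_ball_zero_iff] at hz ⊢
          rw [norm_smul]
          exact (mul_le_mul_of_nonneg_right hz.le (norm_nonneg _)).trans_lt hy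
        -- All iterates stay in the bounded set `U`, while their degree `k` term grows linearly in
        -- `m`; so that term must vanish.
        have bound : ∀ m : ℕ, (m : ℝ) * ‖p k fun _ => y‖ ≤ C + C := fun m => by
          have := norm_le_of_sub_pow_smul_isBigO (ψ := fun z => F^[m] (z • y) - z • y)
            (c := (m : ℂ) • p k fun _ => y) (k := k) (M := C + C) ?_ ?_ ?_
          · simpa [norm_smul] using this
          · refine DifferentiableOn.sub ?_ (by fun_prop)
            exact (analyticOnNhd_iterate hF hm m).differentiableOn.comp (by fun_prop) hzy
          · intro z hz
            have hzU := hzy z (by simp [hz])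
            refine (norm_sub_le _ _).trans (add_le_add (hC _ ?_) (hC _ hzU))
            exact hm.iterate m hzU
          · have ht : Tendsto (fun z : ℂ => z • y) (𝓝 0) (𝓝 0) := by
              have : Continuous fun z : ℂ => z • y := by fun_prop
              simpa using this.tendsto 0
            have h2 := (iterate_sub_isBigO hk h1 m).comp_tendsto ht
            refine (h2.congr_left (f₂ := fun z => F^[m] (z • y) - z • y -
              z ^ k • (m : ℂ) • p k fun _ => y) fun z => ?_).trans
              (IsBigO.of_bound (‖y‖ ^ (k + 1)) (Eventually.of_forall fun z => ?_))
            · have e : (p k fun _ => z • y) = z ^ k • p k fun _ => y := by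
                simpa using (p k).map_smul_univ (fun _ => z) fun _ => y
              simp only [Function.comp_apply, e]
              rw [smul_comm]
              abel
            · simp [norm_smul, mul_pow, mul_comm]
        by_contra hne
        obtain ⟨m, hm'⟩ := exists_nat_gt ((C + C) / ‖p k fun _ => y‖)
        rw [div_lt_iff₀ (norm_pos_iff.2 hne)] at hm'
        exact absurd (bound m) (not_le.2 hm')
      intro y
      -- By homogeneity it suffices to treat a multiple of `y` short enough for `small`.
      set t : ℝ := r / (4 * (‖y‖ + 1)) with ht
      have hy1 : 0 < ‖y‖ + 1 := by positivity
      have ht0 : 0 < t := by positivity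
      have h2 : (p k fun _ => (t : ℂ) • y) = (t : ℂ) ^ k • p k fun _ => y := by
        simpa using (p k).map_smul_univ (fun _ => (t : ℂ)) fun _ => y
      rw [small] at h2
      · refine (smul_eq_zero.1 h2.symm).resolve_left (pow_ne_zero _ ?_)
        exact_mod_cast ht0.ne'
      · rw [norm_smul, Complex.norm_real, Real.norm_of_nonneg ht0.le, ht]
        have : 2 * (r / (4 * (‖y‖ + 1)) * ‖y‖) = r * (‖y‖ / (2 * (‖y‖ + 1))) := by
          field_simp; ring
        rw [this]
        refine mul_lt_of_lt_one_right hr ?_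
        rw [div_lt_one (by positivity)]
        linarith [norm_nonneg y]
  refine hF.eqOn_of_preconnected_of_eventuallyEq analyticOnNhd_id hUc h0 ?_
  filter_upwards [hp.eventually_hasSum] with y hy
  rw [zero_add] at hy
  refine hy.unique ?_
  have := hasSum_single (f := fun n => p n fun _ => y) 1 fun b hb => ?_
  · rwa [hp1] at this
  · rcases Nat.lt_or_ge b 2 with h | h
    · obtain rfl : b = 0 := by omega
      exact hp0 y
    · exact key b h y

/-- A map commuting with rotations is linear. -/
theorem eqOn_fderiv_of_commute_rotation {U : Set E} (hUo : IsOpen U)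
    (hUc : IsPreconnected U) (h0 : (0 : E) ∈ U) {f : E → E} (hf : AnalyticOnNhd ℂ f U)
    (hrot : ∀ x ∈ U, ∀ t : ℝ, f (Complex.exp (t * Complex.I) • x) =
      Complex.exp (t * Complex.I) • f x) : EqOn f (fderiv ℂ f 0) U := by
  refine hf.eqOn_of_preconnected_of_eventuallyEq (fun x _ => (fderiv ℂ f 0).analyticAt x) hUc h0 ?_
  obtain ⟨r, hr, hrU⟩ := Metric.isOpen_iff.1 hUo 0 h0
  filter_upwards [Metric.ball_mem_nhds (0 : E) (half_pos hr)] with y hy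
  rw [mem_ball_zero_iff] at hy
  have hzy : ∀ z ∈ Metric.ball (0 : ℂ) 2, z • y ∈ U := fun z hz => by
    apply hrU
    rw [mem_ball_zero_iff] at hz ⊢
    rw [norm_smul]
    refine (mul_le_mul_of_nonneg_right hz.le (norm_nonneg _)).trans_lt ?_
    linarith
  have hsm : ∀ v : E, AnalyticOnNhd ℂ (fun z : ℂ => z • v) (Metric.ball 0 2) :=
    fun v z _ => analyticAt_id.smul analyticAt_const
  have hyU : y ∈ U := by simpa using hzy 1 (by simp)
  have heq : EqOn (fun z : ℂ => f (z • y)) (fun z => z • f y) (Metric.ball 0 2) := by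
    refine AnalyticOnNhd.eqOn_of_preconnected_of_frequently_eq
      (hf.comp (hsm y) hzy) (hsm (f y)) (convex_ball _ _).isPreconnected (z₀ := 1) (by simp) ?_
    -- Rotations accumulate at `1`, so the identity theorem extends the relation from the circle to
    -- the disc; differentiating at `z = 0` then gives linearity.
    have hlim : Tendsto (fun t : ℝ => Complex.exp (t * Complex.I)) (𝓝[≠] 0) (𝓝[≠] 1) := by
      refine tendsto_nhdsWithin_iff.2 ⟨?_, ?_⟩
      · have : Continuous fun t : ℝ => Complex.exp (t * Complex.I) := by fun_prop
        simpa using (this.tendsto 0).mono_left nhdsWithin_le_nhds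
      · have hpi : ∀ᶠ t : ℝ in 𝓝[≠] 0, t ∈ Ioo (-1 : ℝ) 1 :=
          nhdsWithin_le_nhds (Ioo_mem_nhds (by norm_num) (by norm_num))
        filter_upwards [self_mem_nhdsWithin, hpi] with t ht htp h
        have him := congrArg Complex.im (show Complex.exp (t * Complex.I) = 1 from h)
        rw [Complex.exp_ofReal_mul_I_im, Complex.one_im,
          Real.sin_eq_zero_iff_of_lt_of_lt (by linarith [htp.1, Real.pi_gt_three])
            (by linarith [htp.2, Real.pi_gt_three])] at him
        exact ht him
    exact hlim.frequently (Eventually.of_forall fun t => hrot y hyU t).frequently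
  have hd1 : HasDerivAt (fun z : ℂ => f (z • y)) (fderiv ℂ f 0 y) 0 := by
    have h1 : HasFDerivAt f (fderiv ℂ f 0) ((0 : ℂ) • y) := by
      rw [zero_smul]; exact (hf 0 h0).differentiableAt.hasFDerivAt
    have h2 : HasDerivAt (fun z : ℂ => z • y) ((1 : ℂ) • y) 0 := (hasDerivAt_id _).smul_const y
    rw [one_smul] at h2
    exact h1.comp_hasDerivAt 0 h2
  have hd2 : HasDerivAt (fun z : ℂ => f (z • y)) ((1 : ℂ) • f y) 0 :=
    ((hasDerivAt_id _).smul_const (f y)).congr_of_eventuallyEq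
      (heq.eventuallyEq_of_mem (Metric.ball_mem_nhds _ two_pos))
  simpa using hd2.unique hd1

/-- The inverse of an injective analytic map with invertible derivatives is analytic. -/
theorem analyticOnNhd_invFunOn [FiniteDimensional ℂ E] {U : Set E} (hUo : IsOpen U) {f : E → E}
    (hf : AnalyticOnNhd ℂ f U) (hinj : InjOn f U)
    (hd : ∀ x ∈ U, Function.Injective (fderiv ℂ f x)) :
    AnalyticOnNhd ℂ (Function.invFunOn f U) (f '' U) := by
  have := FiniteDimensional.complete ℂ E
  rintro _ ⟨x, hx, rfl⟩
  let e : E ≃L[ℂ] E :=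
    (LinearEquiv.ofInjectiveEndo (fderiv ℂ f x : E →ₗ[ℂ] E) (hd x hx)).toContinuousLinearEquiv
  have he : (e : E →L[ℂ] E) = fderiv ℂ f x := by ext v; rfl
  have hs : HasStrictFDerivAt f (e : E →L[ℂ] E) x := by rw [he]; exact (hf x hx).hasStrictFDerivAt
  let φ := hs.toOpenPartialHomeomorph f
  have hxφ : x ∈ φ.source := hs.mem_toOpenPartialHomeomorph_source
  have hφ : (φ : E → E) = f := hs.toOpenPartialHomeomorph_coe
  have hsymm : φ.symm (f x) = x := by rw [← hφ]; exact φ.left_inv hxφ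
  have hfx : f x ∈ φ.target := by rw [← hφ]; exact φ.map_source hxφ
  have hφa : AnalyticAt ℂ φ.symm (f x) := by
    -- The order `⊤` is the analytic class, above `C^∞`.
    have h1 : ContDiffAt ℂ ⊤ φ.symm (f x) := by
      refine φ.contDiffAt_symm (f₀' := e) hfx ?_ ?_
      · rw [hsymm, hφ]; exact hs.hasFDerivAt
      · rw [hsymm, hφ]; exact (hf x hx).contDiffAt
    exact h1.analyticAt
  refine hφa.congr ?_
  have hcont : ContinuousAt φ.symm (f x) := φ.continuousAt_symm hfx
  have hU : ∀ᶠ y in 𝓝 (f x), φ.symm y ∈ U :=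
    hcont.eventually (by rw [hsymm]; exact hUo.mem_nhds hx)
  filter_upwards [hU, φ.open_target.mem_nhds hfx] with y hy hyt
  have h1 : f (φ.symm y) = y := by rw [← hφ]; exact φ.right_inv hyt
  conv_rhs => rw [← h1]
  exact (hinj.leftInvOn_invFunOn hy).symm

theorem isOpen_image_of_fderiv_injective [FiniteDimensional ℂ E] {U : Set E} (hUo : IsOpen U)
    {f : E → E} (hf : AnalyticOnNhd ℂ f U)
    (hd : ∀ x ∈ U, Function.Injective (fderiv ℂ f x)) : IsOpen (f '' U) := by
  have := FiniteDimensional.complete ℂ E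
  rw [isOpen_iff_mem_nhds]
  rintro _ ⟨x, hx, rfl⟩
  let e : E ≃L[ℂ] E :=
    (LinearEquiv.ofInjectiveEndo (fderiv ℂ f x : E →ₗ[ℂ] E) (hd x hx)).toContinuousLinearEquiv
  have he : (e : E →L[ℂ] E) = fderiv ℂ f x := by ext v; rfl
  have hs : HasStrictFDerivAt f (e : E →L[ℂ] E) x := by rw [he]; exact (hf x hx).hasStrictFDerivAt
  rw [← hs.map_nhds_eq_of_equiv]
  exact image_mem_map (hUo.mem_nhds hx)

/-- A proper map with open image onto a part of a connected set is surjective. -/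
theorem image_eq_of_proper [FiniteDimensional ℂ E] {U V : Set E} (hVo : IsOpen V)
    (hVc : IsPreconnected V) (hU : U.Nonempty) {f : E → E} (hf : ContinuousOn f U)
    (hm : MapsTo f U V) (hi : IsOpen (f '' U))
    (hp : ∀ K ⊆ V, IsCompact K → IsCompact (U ∩ f ⁻¹' K)) : f '' U = V := by
  have := FiniteDimensional.proper ℂ E
  refine hm.image_subset.antisymm (hVc.subset_of_closure_inter_subset hi ?_ ?_)
  · obtain ⟨x, hx⟩ := hU
    exact ⟨f x, hm hx, x, hx, rfl⟩
  · rintro y ⟨hy, hyV⟩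
    obtain ⟨K, hK, hKV, hKc⟩ := local_compact_nhds (hVo.mem_nhds hyV)
    have hc : IsClosed (f '' (U ∩ f ⁻¹' K)) :=
      ((hp K hKV hKc).image_of_continuousOn (hf.mono inter_subset_left)).isClosed
    rw [image_inter_preimage] at hc
    have : y ∈ f '' U ∩ K := by
      rw [← hc.closure_eq, mem_closure_iff_nhds]
      intro t ht
      obtain ⟨z, hz, hzU⟩ := mem_closure_iff_nhds.1 hy _ (inter_mem ht hK)
      exact ⟨z, hz.1, hzU, hz.2⟩
    exact this.1

/-- Cartan's theorem on biholomorphic maps of circular domains fixing the origin. -/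
theorem eqOn_fderiv_of_circular [FiniteDimensional ℂ E] {U V : Set E} (hUo : IsOpen U)
    (hUc : IsPreconnected U) (hUb : Bornology.IsBounded U) (h0 : (0 : E) ∈ U)
    (hUr : ∀ x ∈ U, ∀ t : ℝ, Complex.exp (t * Complex.I) • x ∈ U)
    (hVr : ∀ x ∈ V, ∀ t : ℝ, Complex.exp (t * Complex.I) • x ∈ V)
    {f : E → E} (hf : AnalyticOnNhd ℂ f U) (hf0 : f 0 = 0) (hinj : InjOn f U) (hUV : f '' U = V)
    (hd : ∀ x ∈ U, Function.Injective (fderiv ℂ f x)) : EqOn f (fderiv ℂ f 0) U := by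
  have := FiniteDimensional.complete ℂ E
  refine eqOn_fderiv_of_commute_rotation hUo hUc h0 hf fun x hx t => ?_
  set G := Function.invFunOn f U with hG
  have hGa : AnalyticOnNhd ℂ G V := hUV ▸ analyticOnNhd_invFunOn hUo hf hinj hd
  have hGf : ∀ x ∈ U, G (f x) = x := fun x hx => hinj.leftInvOn_invFunOn hx
  have hm : MapsTo f U V := fun x hx => hUV ▸ mem_image_of_mem f hx
  have hGV : ∀ y ∈ V, G y ∈ U ∧ f (G y) = y := by
    rintro y hy
    rw [← hUV] at hy
    obtain ⟨x, hx, rfl⟩ := hy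
    rw [hGf x hx]
    exact ⟨hx, rfl⟩
  set c := Complex.exp (t * Complex.I) with hc
  set d := Complex.exp ((-t : ℝ) * Complex.I) with hdd
  have hcd : d * c = 1 := by
    rw [hc, hdd, ← Complex.exp_add]
    simp
  have hrotA : ∀ (a : ℂ) (S : Set E), AnalyticOnNhd ℂ (fun x => a • x) S :=
    fun a S z _ => analyticAt_const.smul analyticAt_id
  have h1 : AnalyticOnNhd ℂ (fun x => d • f (c • x)) U :=
    (hrotA d univ).comp (hf.comp (hrotA c U) fun x hx => hUr x hx t) (mapsTo_univ _ _)
  have h1m : MapsTo (fun x => d • f (c • x)) U V := fun x hx => hVr _ (hm (hUr x hx t)) (-t)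
  have h2 : AnalyticOnNhd ℂ (fun x => G (d • f (c • x))) U := hGa.comp h1 h1m
  -- The factors `c` and `d` cancel in the derivative at `0`, leaving that of `G ∘ f`.
  have hid : EqOn (fun x => G (d • f (c • x))) id U := by
    refine eqOn_id_of_mapsTo_of_fderiv_eq_id hUo hUc hUb h0 h2
      (fun x hx => (hGV _ (h1m hx)).1) ?_ ?_
    · simp only [smul_zero, hf0]
      simpa [hf0] using hGf 0 h0
    · have hfd : HasFDerivAt f (fderiv ℂ f 0) 0 := (hf 0 h0).differentiableAt.hasFDerivAt
      have hV0 : (0 : E) ∈ V := hf0 ▸ hm h0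
      have hGd : HasFDerivAt G (fderiv ℂ G 0) 0 := (hGa 0 hV0).differentiableAt.hasFDerivAt
      have hcomp : (fderiv ℂ G 0).comp (fderiv ℂ f 0) = ContinuousLinearMap.id ℂ E := by
        have e1 : HasFDerivAt (G ∘ f) ((fderiv ℂ G 0).comp (fderiv ℂ f 0)) 0 :=
          HasFDerivAt.comp 0 (by rwa [hf0]) hfd
        have e2 : G ∘ f =ᶠ[𝓝 0] id := by
          filter_upwards [hUo.mem_nhds h0] with x hx using hGf x hx
        exact (e1.congr_of_eventuallyEq e2.symm).unique (hasFDerivAt_id 0)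
      have e1 : HasFDerivAt (fun x => d • f (c • x)) (fderiv ℂ f 0) 0 := by
        have i1 : HasFDerivAt (fun x : E => c • x) (c • ContinuousLinearMap.id ℂ E) 0 :=
          (hasFDerivAt_id 0).const_smul c
        have i2 : HasFDerivAt (fun x => f (c • x))
            ((fderiv ℂ f 0).comp (c • ContinuousLinearMap.id ℂ E)) 0 :=
          HasFDerivAt.comp 0 (by rwa [smul_zero]) i1
        have e : d • (fderiv ℂ f 0).comp (c • ContinuousLinearMap.id ℂ E) = fderiv ℂ f 0 := by
          ext v
          simp [smul_smul, hcd]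
        rw [← e]
        exact i2.const_smul d
      have e2 : HasFDerivAt (fun x => G (d • f (c • x))) ((fderiv ℂ G 0).comp (fderiv ℂ f 0)) 0 :=
        HasFDerivAt.comp (g := G) 0 (by simpa [hf0] using hGd) e1
      rw [e2.fderiv, hcomp]
  have h3 : f (G (d • f (c • x))) = f x := congrArg f (hid hx)
  rw [(hGV _ (h1m hx)).2] at h3
  rw [← h3, smul_smul, mul_comm, hcd, one_smul]

theorem convex_iff_of_eqOn_linear {U V : Set E} {f : E → E} {L : E →L[ℂ] E} (hL : EqOn f L U)
    (hinj : Function.Injective L) (hUV : f '' U = V) : Convex ℝ U ↔ Convex ℝ V := by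
  have hV : V = (L.restrictScalars ℝ : E →ₗ[ℝ] E) '' U := by
    rw [← hUV]
    exact hL.image_eq
  constructor
  · intro h
    rw [hV]
    exact h.linear_image _
  · intro h
    have : U = (L.restrictScalars ℝ : E →ₗ[ℝ] E) ⁻¹' V := by
      rw [hV, preimage_image_eq]
      exact hinj
    rw [this]
    exact h.linear_preimage _

end Cartan

namespace NC

/-! ### Free maps on block triangular tuples -/

section FreeMaps

attribute [local instance] Matrix.normedAddCommGroup Matrix.normedSpace

variable {g h n : ℕ}

/-- The tuple of block upper triangular matrices with diagonal `X`, `Y` and corner `H`. -/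
def upperTri (X H Y : Tuple g n) : Tuple g (n + n) := fun i =>
  Matrix.reindex finSumFinEquiv finSumFinEquiv (Matrix.fromBlocks (X i) (H i) 0 (Y i))

/-- The upper right block. -/
def corner (Z : Tuple g (n + n)) : Tuple g n := fun i =>
  (Z i).submatrix (Fin.castAdd n) (Fin.natAdd n)

theorem upperTri_zero (X Y : Tuple g n) : upperTri X 0 Y = directSum X Y := rfl

@[simp] theorem corner_upperTri (X H Y : Tuple g n) : corner (upperTri X H Y) = H := by
  funext i
  ext a b
  simp only [corner, upperTri, Matrix.submatrix_apply, Matrix.reindex_apply,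
    finSumFinEquiv_symm_apply_castAdd, finSumFinEquiv_symm_apply_natAdd, Matrix.fromBlocks_apply₁₂]

theorem continuous_corner : Continuous (corner : Tuple g (n + n) → Tuple g n) := by
  refine continuous_pi fun i => ?_
  exact (continuous_apply i).matrix_submatrix _ _

theorem continuous_upperTri :
    Continuous fun p : Tuple g n × Tuple g n × Tuple g n => upperTri p.1 p.2.1 p.2.2 := by
  refine continuous_pi fun i => ?_
  have h1 : Continuous fun p : Tuple g n × Tuple g n × Tuple g n => p.1 i :=
    (continuous_apply i).comp continuous_fst
  have h2 : Continuous fun p : Tuple g n × Tuple g n × Tuple g n => p.2.1 i :=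
    (continuous_apply i).comp (continuous_fst.comp continuous_snd)
  have h3 : Continuous fun p : Tuple g n × Tuple g n × Tuple g n => p.2.2 i :=
    (continuous_apply i).comp (continuous_snd.comp continuous_snd)
  exact (Continuous.matrix_fromBlocks h1 h2 continuous_const h3).matrix_reindex _ _

/-- The unipotent matrix with scalar corner `γ`. -/
def shear (n : ℕ) (γ : ℂ) : Matrix (Fin (n + n)) (Fin (n + n)) ℂ :=
  Matrix.reindex finSumFinEquiv finSumFinEquiv (Matrix.fromBlocks 1 (γ • 1) 0 1)

theorem isUnit_shear (γ : ℂ) : IsUnit (shear n γ) := by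
  have key : ∀ a b : ℂ, a + b = 0 → shear n a * shear n b = 1 := fun a b hab => by
    simp [shear, Matrix.submatrix_mul_equiv, Matrix.fromBlocks_multiply, ← add_smul,
      add_comm b a, hab]
  exact ⟨⟨shear n γ, shear n (-γ), key _ _ (by ring), key _ _ (by ring)⟩, rfl⟩

theorem directSum_mul_shear (A B : Tuple g n) (γ : ℂ) (i : Fin g) :
    directSum A B i * shear n γ = shear n γ * upperTri A (γ • (A - B)) B i := by
  simp [shear, directSum, upperTri, Matrix.submatrix_mul_equiv, Matrix.fromBlocks_multiply,
    smul_sub]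

variable {U : SetSeq g} {V : SetSeq h} {f : MapSeq g h}

theorem map_upperTri (hU : IsNCSet U) (hf : IsFreeMapOn f U) {X Y : Tuple g n} (hX : X ∈ U n)
    (hY : Y ∈ U n) {γ : ℂ} (hZ : upperTri X (γ • (X - Y)) Y ∈ U (n + n)) :
    f (n + n) (upperTri X (γ • (X - Y)) Y) =
      upperTri (f n X) (γ • (f n X - f n Y)) (f n Y) := by
  funext i
  have h1 := hf.map_similar (n + n) _ _ (hU.directSum_mem n n X Y hX hY) hZ (shear n γ)
    (isUnit_shear γ) (directSum_mul_shear X Y γ) i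
  rw [hf.map_directSum n n X Y hX hY, directSum_mul_shear] at h1
  exact ((isUnit_shear γ).mul_left_cancel h1).symm

/-- Proper free maps are injective. -/
theorem injOn_of_proper (hU : IsNCDomain U) (hV : IsNCSet V) (hfUV : MapsInto f U V)
    (hf : IsFreeMapOn f U) (hfp : IsProper f U V) : InjOn (f n) (U n) := by
  intro X hX Y hY hXY
  set Z : ℂ → Tuple g (n + n) := fun c => upperTri X (c • (X - Y)) Y with hZ
  have hZc : Continuous Z := continuous_upperTri.comp
    (continuous_const.prodMk ((continuous_id.smul continuous_const).prodMk continuous_const))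
  set K := U (n + n) ∩ f (n + n) ⁻¹' {directSum (f n X) (f n Y)} with hK
  have hKc : IsCompact K := by
    refine hfp _ _ (singleton_subset_iff.2 ?_) isCompact_singleton
    exact hV.directSum_mem n n _ _ (hfUV n hX) (hfUV n hY)
  -- Since `f X = f Y`, the map is constant on the part of the line inside `U`. That part is
  -- therefore both open and closed, hence the whole line, yet its corners stay in a compact set.
  have hpre : Z ⁻¹' U (n + n) = Z ⁻¹' K := by
    ext c
    refine ⟨fun hc => ⟨hc, ?_⟩, fun hc => hc.1⟩
    have := map_upperTri hU.toIsNCSet hf hX hY hc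
    rw [hXY, sub_self, smul_zero, upperTri_zero] at this
    rw [mem_preimage, mem_singleton_iff, hXY]
    exact this
  have hclopen : IsClopen (Z ⁻¹' U (n + n)) :=
    ⟨hpre ▸ hKc.isClosed.preimage hZc, (hU.isOpen _).preimage hZc⟩
  have huniv := hclopen.eq_univ ⟨0, by
    simpa [hZ, upperTri_zero] using hU.directSum_mem n n X Y hX hY⟩
  rw [hpre] at huniv
  obtain ⟨R, hR⟩ := (hKc.image continuous_corner).isBounded.exists_norm_le
  have hb : ∀ c : ℂ, ‖c • (X - Y)‖ ≤ R := fun c =>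
    hR _ ⟨Z c, (huniv ▸ mem_univ c : c ∈ Z ⁻¹' K), corner_upperTri _ _ _⟩
  by_contra hne
  have hpos : 0 < ‖X - Y‖ := norm_pos_iff.2 (sub_ne_zero.2 hne)
  obtain ⟨m, hm⟩ := exists_nat_gt (R / ‖X - Y‖)
  rw [div_lt_iff₀ hpos] at hm
  have := hb m
  rw [norm_smul, Complex.norm_natCast] at this
  exact absurd this (not_le.2 hm)

/-- The corner of a free map on a tuple with constant diagonal is its derivative. -/
theorem map_upperTri_same (hU : IsNCDomain U) (hf : IsFreeMapOn f U) (hfa : IsAnalyticOn f U)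
    {X H : Tuple g n} (hX : X ∈ U n) (hZ : upperTri X H X ∈ U (n + n)) :
    f (n + n) (upperTri X H X) = upperTri (f n X) (fderiv ℂ (f n) X H) (f n X) := by
  -- With `γ = t⁻¹` the corner `γ (X - Y t)` is exactly `H`, and its image is a difference quotient
  -- of `f`.
  set Y : ℂ → Tuple g n := fun t => X - t • H with hY
  have hYc : Continuous Y := continuous_const.sub (continuous_id.smul continuous_const)
  have hY0 : Y 0 = X := by simp [hY]
  set W : ℂ → Tuple g (n + n) := fun t => upperTri X H (Y t) with hW
  have hWc : Continuous W :=
    continuous_upperTri.comp (continuous_const.prodMk (continuous_const.prodMk hYc))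
  have hW0 : W 0 = upperTri X H X := by simp only [hW, hY0]
  have l1 : Tendsto (fun t => f (n + n) (W t)) (𝓝[≠] 0) (𝓝 (f (n + n) (upperTri X H X))) := by
    have := ((hfa _ _ hZ).continuousAt.tendsto.comp (hW0 ▸ hWc.tendsto 0)).mono_left
      (nhdsWithin_le_nhds (s := {0}ᶜ))
    exact this
  have hd : HasDerivAt (fun t => f n (Y t)) (fderiv ℂ (f n) X (-H)) 0 := by
    have h1 : HasFDerivAt (f n) (fderiv ℂ (f n) X) (Y 0) := by
      rw [hY0]
      exact (hfa n X hX).differentiableAt.hasFDerivAt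
    have h2 : HasDerivAt Y (-((1 : ℂ) • H)) 0 := ((hasDerivAt_id _).smul_const H).const_sub X
    rw [one_smul] at h2
    exact h1.comp_hasDerivAt 0 h2
  have l2 : Tendsto (fun t : ℂ => t⁻¹ • (f n X - f n (Y t))) (𝓝[≠] 0)
      (𝓝 (fderiv ℂ (f n) X H)) := by
    have := (hasDerivAt_iff_tendsto_slope_zero.1 hd).neg
    rw [map_neg, neg_neg] at this
    refine this.congr fun t => ?_
    rw [zero_add, hY0, ← smul_neg, neg_sub]
  have l3 : Tendsto (fun t => f n (Y t)) (𝓝[≠] 0) (𝓝 (f n X)) := by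
    have := hd.continuousAt.tendsto.mono_left (nhdsWithin_le_nhds (s := {0}ᶜ))
    rwa [hY0] at this
  have l4 := (continuous_upperTri.tendsto (f n X, fderiv ℂ (f n) X H, f n X)).comp
    ((tendsto_const_nhds (x := f n X)).prodMk_nhds (l2.prodMk_nhds l3))
  refine tendsto_nhds_unique l1 (l4.congr' ?_)
  have e1 : ∀ᶠ t in 𝓝[≠] (0 : ℂ), Y t ∈ U n := nhdsWithin_le_nhds
    (hYc.continuousAt.eventually (by rw [hY0]; exact (hU.isOpen n).mem_nhds hX))
  have e2 : ∀ᶠ t in 𝓝[≠] (0 : ℂ), W t ∈ U (n + n) := nhdsWithin_le_nhds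
    (hWc.continuousAt.eventually (by rw [hW0]; exact (hU.isOpen _).mem_nhds hZ))
  filter_upwards [e1, e2, self_mem_nhdsWithin] with t ht1 ht2 ht
  have e : t⁻¹ • (X - Y t) = H := by
    rw [hY, sub_sub_cancel, smul_smul, inv_mul_cancel₀ ht, one_smul]
  have := map_upperTri hU.toIsNCSet hf hX ht1 (γ := t⁻¹) (by rw [e]; exact ht2)
  rw [e] at this
  exact this.symm

/-- For `H` in the kernel and small `t ≠ 0`, the tuples with diagonal `X`, `X` and corners `t H` and
`0` have the same image. -/
theorem fderiv_injective_of_injOn (hU : IsNCDomain U) (hf : IsFreeMapOn f U)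
    (hfa : IsAnalyticOn f U) (hinj : InjOn (f (n + n)) (U (n + n))) {X : Tuple g n}
    (hX : X ∈ U n) : Function.Injective (fderiv ℂ (f n) X) := by
  rw [injective_iff_map_eq_zero]
  intro H hH
  have hXX := hU.directSum_mem n n X X hX hX
  have hc : Continuous fun t : ℂ => upperTri X (t • H) X := continuous_upperTri.comp
    (continuous_const.prodMk ((continuous_id.smul continuous_const).prodMk continuous_const))
  have e1 : ∀ᶠ t in 𝓝[≠] (0 : ℂ), upperTri X (t • H) X ∈ U (n + n) := nhdsWithin_le_nhds
    (hc.continuousAt.eventually (by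
      simp only [zero_smul, upperTri_zero]; exact (hU.isOpen _).mem_nhds hXX))
  obtain ⟨t, ht, ht0⟩ := (e1.and self_mem_nhdsWithin).exists
  have h1 := map_upperTri_same hU hf hfa hX ht
  rw [map_smul, hH, smul_zero, upperTri_zero, ← hf.map_directSum n n X X hX hX] at h1
  have h2 := congrArg corner (hinj ht hXX h1)
  rw [← upperTri_zero, corner_upperTri, corner_upperTri] at h2
  exact (smul_eq_zero.1 h2).resolve_left ht0

open scoped ComplexOrder in
theorem isBounded_level (hU : IsBounded U) : Bornology.IsBounded (U n) := by
  obtain ⟨C, hC⟩ := hU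
  refine isBounded_iff_forall_norm_le.2 ⟨|C|, fun X hX => ?_⟩
  refine (pi_norm_le_iff_of_nonneg (abs_nonneg C)).2 fun j =>
    (Matrix.norm_le_iff (abs_nonneg C)).2 fun a b => ?_
  -- A diagonal entry of the positive definite matrix bounds the sum of squares along row `a` of all
  -- the `X j`.
  have h1 := (hC n X hX).diag_pos (i := a)
  have h2 : ((((C : ℂ) ^ 2) • (1 : Matrix (Fin n) (Fin n) ℂ) -
      ∑ j, X j * (X j).conjTranspose) a a) =
      ((C ^ 2 - ∑ j, ∑ b, ‖X j a b‖ ^ 2 : ℝ) : ℂ) := by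
    simp [Matrix.sum_apply, Matrix.mul_apply, Complex.mul_conj, Complex.normSq_eq_norm_sq]
  rw [h2, Complex.zero_lt_real, sub_pos] at h1
  refine abs_le_of_sq_le_sq' ?_ (abs_nonneg C) |>.2
  rw [sq_abs]
  refine le_trans ?_ h1.le
  calc ‖X j a b‖ ^ 2 ≤ ∑ b, ‖X j a b‖ ^ 2 :=
        Finset.single_le_sum (f := fun b => ‖X j a b‖ ^ 2) (fun _ _ => by positivity)
          (Finset.mem_univ b)
    _ ≤ _ := Finset.single_le_sum (f := fun j => ∑ b, ‖X j a b‖ ^ 2)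
          (fun _ _ => by positivity) (Finset.mem_univ j)

end FreeMaps

/-! ### Transfer of convexity at a fixed level -/

section Convexity

attribute [local instance] Matrix.normedAddCommGroup Matrix.normedSpace

theorem convex_level_iff {g : ℕ} {U V : SetSeq g} (hU : IsNCDomain U) (hV : IsNCDomain V)
    (hUb : IsBounded U) (hU0 : ∀ n : ℕ, (0 : Tuple g n) ∈ U n) {f : MapSeq g g}
    (hfUV : MapsInto f U V) (hf : IsFreeMapOn f U) (hfa : IsAnalyticOn f U)
    (hfp : IsProper f U V) (hf0 : ∀ n : ℕ, f n 0 = 0) (hUc : IsCircular U) (hVc : IsCircular V)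
    (n : ℕ) : Convex ℝ (U n) ↔ Convex ℝ (V n) := by
  have hinj : ∀ m, InjOn (f m) (U m) := fun m => injOn_of_proper hU hV.toIsNCSet hfUV hf hfp
  have hd : ∀ X ∈ U n, Function.Injective (fderiv ℂ (f n) X) := fun X hX =>
    fderiv_injective_of_injOn hU hf hfa (hinj _) hX
  have himg : f n '' U n = V n :=
    image_eq_of_proper (hV.isOpen n) (hV.isConnected n).isPreconnected ⟨0, hU0 n⟩
      (hfa n).continuousOn (hfUV n) (isOpen_image_of_fderiv_injective (hU.isOpen n) (hfa n) hd)
      (hfp n)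
  exact convex_iff_of_eqOn_linear
    (eqOn_fderiv_of_circular (hU.isOpen n) (hU.isConnected n).isPreconnected (isBounded_level hUb)
      (hU0 n) (hUc n) (hVc n) (hfa n) (hf0 n) (hinj n) himg hd)
    (hd 0 (hU0 n)) himg

end Convexity

end NC

theorem mainTheorem4 (g : ℕ) (U V : NC.SetSeq g)
    (hU : NC.IsNCDomain U) (hV : NC.IsNCDomain V)
    (hUb : NC.IsBounded U) (hVb : NC.IsBounded V)
    (hU0 : ∀ n : ℕ, (0 : NC.Tuple g n) ∈ U n) (hV0 : ∀ n : ℕ, (0 : NC.Tuple g n) ∈ V n)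
    (f : NC.MapSeq g g) (hfUV : NC.MapsInto f U V)
    (hf : NC.IsFreeMapOn f U) (hfa : NC.IsAnalyticOn f U) (hfp : NC.IsProper f U V)
    (hf0 : ∀ n : ℕ, f n 0 = 0)
    (hUc : NC.IsCircular U) (hVc : NC.IsCircular V) :
    NC.IsWeaklyConvex U ↔ NC.IsWeaklyConvex V :=
  forall_congr' (NC.convex_level_iff hU hV hUb hU0 hfUV hf hfa hfp hf0 hUc hVc)
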